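/- Let $\mathcal H$ be a real Hilbert space and let $S:\mathcal H\to\mathcal H$ be bounded, linear, self-adjoint and strongly monotone ($\langle Sx,x\rangle\ge c\|x\|^2$ for all $x$ and some $c>0$). Write $\|x\|_S=\sqrt{\langle Sx,x\rangle}$ and $\|x\|_{S^{-1}}=\sqrt{\langle S^{-1}x,x\rangle}$, and call $T:\mathcal H\to\mathcal H$ $L$-Lipschitz with respect to $S$ if $\|Tx-Ty\|_{S^{-1}}\le L\|x-y\|_S$ for all $x,y$. Assume that (i) $A:\mathcal H\to 2^{\mathcal H}$ is maximally monotone; (ii) $B:\mathcal H\to\mathcal H$ is monotone and $\mu$-Lipschitz with respect to $S$, where $\mu\ge 0$; (iii) $C:\mathcal H\to\mathcal H$ is $\beta^{-1}$-cocoercive with respect to $S$ for some $\beta>0$, that is, $\langle Cx-Cy,x-y\rangle\ge\beta^{-1}\|Cx-Cy\|_{S^{-1}}^2$ for all $x,y$; (iv) $\operatorname{zer}(A+B+C)=\{x\in\mathcal H: 0\in Ax+Bx+Cx\}$ is nonempty; (v) $\gamma>0$ and $M_k:\mathcal H\to\mathcal H$ $(k\ge 0)$ are (possibly nonlinear) operators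 such that $\gamma M_k-S$ is $L_k$-Lipschitz with respect to $S$ for some $L_k\in[0,1)$. Let $x_{-1},x_0,u_0\in\mathcal H$ be arbitrary, and let $(x_k)$, $(y_k)$, $(u_k)$ be generated, for $k=0,1,2,\dots$, by $$ \begin{aligned} y_k&=2x_k-x_{k-1},\\ x_{k+1}&=(M_k+A)^{-1}\bigl(M_kx_k-By_k-Cx_k+\gamma^{-1}u_k\bigr),\\ u_{k+1}&=(\gamma M_k-S)x_{k+1}-(\gamma M_k-S)x_k . \end{aligned} $$ Let $\varepsilon_2>0$ and suppose that there is a constant $\epsilon>0$ such that $$ 1-3L_k-\frac{(2+\varepsilon_2+2\varepsilon_2^2)\gamma\beta}{2\varepsilon_2}-L_{k-1}-\gamma\mu(\sqrt2+1)\ \ge\ \epsilon\qquad\text{for all }k\ge 1, $$ $$ 1-L_{k-1}-L_{k-2}-\gamma\mu(\sqrt2+1)\ \ge\ \epsilon\qquad\text{for all }k\ge 2 . $$ Then $(x_k)$ converges weakly to a point of $\operatorname{zer}(A+B+C)$. -/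

import Mathlib

open Filter Topology
open scoped InnerProductSpace Pointwise

namespace MonotoneSplitting

variable {H : Type*} [NormedAddCommGroup H] [InnerProductSpace ℝ H]

/-! Set-valued operators on `H` are functions `H → Set H`; the graph of `A` is
`{(x, u) | u ∈ A x}`. -/

/-- The set of zeros of a set-valued operator. -/
def zer (T : H → Set H) : Set H := {x | 0 ∈ T x}

/-- The inverse of a set-valued operator: `x ∈ T⁻¹ v` if and only if `v ∈ T x`. -/
def inverseOp (T : H → Set H) : H → Set H := fun v => {x | v ∈ T x}

/-- Maximal monotonicity of a set-valued operator: a pair `(x, u)` lies in the graph of `A` if and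
only if `⟪u - v, x - y⟫ ≥ 0` for all `(y, v)` in the graph of `A`. -/
def MaximallyMonotone (A : H → Set H) : Prop :=
  ∀ x u : H, u ∈ A x ↔ ∀ y v : H, v ∈ A y → 0 ≤ ⟪u - v, x - y⟫_ℝ

/-- Monotonicity of a single-valued operator. -/
def MonotoneOp (B : H → H) : Prop :=
  ∀ x y : H, 0 ≤ ⟪B x - B y, x - y⟫_ℝ

/-- The class of bounded linear, self-adjoint, strongly monotone operators on `H`. -/
structure StronglyPositive [CompleteSpace H] (S : H →L[ℝ] H) : Prop where
  selfAdjoint : IsSelfAdjoint S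
  stronglyMonotone : ∃ c : ℝ, 0 < c ∧ ∀ x : H, c * ‖x‖ ^ 2 ≤ ⟪S x, x⟫_ℝ

/-- Such an operator is invertible, so that `S.inverse` below is its genuine inverse. -/
theorem StronglyPositive.isInvertible [CompleteSpace H] {S : H →L[ℝ] H}
    (hS : StronglyPositive S) : S.IsInvertible := by
  obtain ⟨c, hc, h⟩ := hS.stronglyMonotone
  have hco : IsCoercive ((innerSL ℝ).comp S : H →L[ℝ] H →L[ℝ] ℝ) :=
    ⟨c, hc, fun x => by simpa [pow_two, mul_assoc] using h x⟩
  refine ⟨hco.continuousLinearEquivOfBilin, ?_⟩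
  ext v
  refine (hco.unique_continuousLinearEquivOfBilin (f := S v) fun w => ?_).symm
  simp

/-- The norm `‖x‖_S = √⟪S x, x⟫` induced by `S`. -/
noncomputable def normWrt (S : H →L[ℝ] H) (x : H) : ℝ := √⟪S x, x⟫_ℝ

/-- `T` is `L`-Lipschitz with respect to `S`: `‖T x - T y‖_{S⁻¹} ≤ L ‖x - y‖_S`. -/
def LipschitzWrt (S : H →L[ℝ] H) (L : ℝ) (T : H → H) : Prop :=
  ∀ x y : H, normWrt S.inverse (T x - T y) ≤ L * normWrt S (x - y)

/-- `T` is `κ`-cocoercive with respect to `S`: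
`⟪T x - T y, x - y⟫ ≥ κ ‖T x - T y‖_{S⁻¹}²`. -/
def CocoerciveWrt (S : H →L[ℝ] H) (κ : ℝ) (T : H → H) : Prop :=
  ∀ x y : H, κ * normWrt S.inverse (T x - T y) ^ 2 ≤ ⟪T x - T y, x - y⟫_ℝ

/-- The set-valued operator `A + B + C`. -/
def sumOp (A : H → Set H) (B C : H → H) : H → Set H := fun x => A x + {B x} + {C x}

/-- The (set-valued) operator `(M + A)⁻¹`. -/
def warpedResolvent (M : H → H) (A : H → Set H) : H → Set H :=
  inverseOp fun x => {M x} + A x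

/-- The sequences `x`, `y`, `u` are generated by the nonlinear semi-reflected-forward-backward
splitting algorithm with momentum, with step size `γ`, kernels `M k`, and arbitrary initial points
`x 0`, `u 0` and `xPrev` (the last one playing the role of `x_{-1}` in `y_0 = 2 x_0 - x_{-1}`). -/
structure IsNonlinearSRFBS (A : H → Set H) (B C : H → H) (S : H →L[ℝ] H) (M : ℕ → H → H) (γ : ℝ)
    (xPrev : H) (x y u : ℕ → H) : Prop where
  y_zero : y 0 = (2 : ℝ) • x 0 - xPrev
  y_succ : ∀ k : ℕ, y (k + 1) = (2 : ℝ) • x (k + 1) - x k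
  x_succ : ∀ k : ℕ,
    x (k + 1) ∈ warpedResolvent (M k) A (M k (x k) - B (y k) - C (x k) + γ⁻¹ • u k)
  u_succ : ∀ k : ℕ,
    u (k + 1) = (γ • M k (x (k + 1)) - S (x (k + 1))) - (γ • M k (x k) - S (x k))

end MonotoneSplitting

/-! The kernels disappear from the recursion: splitting `γ M_k` into `S` plus the Lipschitz
remainder `γ M_k - S` turns each resolvent step into an inclusion that involves only `S`, `A`, the
forward terms and two consecutive momenta, and `‖u_{k+1}‖_{S⁻¹} ≤ L_k ‖x_{k+1} - x_k‖_S`.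

Monotonicity of `A` is used twice per step, between the new iterate and a zero and between the last
two iterates. Together with monotonicity of `B` this makes a Lyapunov function `energy` decrease by
a multiple of the squared last increment (`energy_le`), while it dominates a multiple of the squared
`S`-distance to the zero (`le_energy`). Hence the iterates are bounded, the increments and momenta
vanish, and the energy differs from `‖x_k - z‖_S ^ 2` by a null sequence, so these distances
converge for every zero `z`.

Opial's lemma then reduces the claim to showing that weak cluster points are zeros. Testing against
a resolvent of `A + F`, with `F = B + C`, settles this. That resolvent comes from Minty's theorem,
proved here by a convexity argument, and a contraction. -/

namespace MonotoneSplitting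

/-! ### Geometry of the norms induced by `S` and its inverse. -/

section SNorm

variable {H : Type*} [NormedAddCommGroup H] [InnerProductSpace ℝ H]
  {S : H →L[ℝ] H}

theorem normWrt_nonneg (S : H →L[ℝ] H) (x : H) : 0 ≤ normWrt S x := Real.sqrt_nonneg _

theorem normWrt_neg (S : H →L[ℝ] H) (x : H) : normWrt S (-x) = normWrt S x := by
  simp [normWrt]

theorem normWrt_le (S : H →L[ℝ] H) (x : H) : normWrt S x ≤ √‖S‖ * ‖x‖ := by
  rw [normWrt, ← Real.sqrt_sq (norm_nonneg x), ← Real.sqrt_mul (norm_nonneg S)]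
  refine Real.sqrt_le_sqrt ((real_inner_le_norm _ _).trans ?_)
  rw [pow_two, ← mul_assoc]
  exact mul_le_mul_of_nonneg_right (S.le_opNorm x) (norm_nonneg x)

theorem CocoerciveWrt.monotoneOp {κ : ℝ} (hκ : 0 ≤ κ) {C : H → H}
    (hC : CocoerciveWrt S κ C) : MonotoneOp C :=
  fun x y => (mul_nonneg hκ (sq_nonneg _)).trans (hC x y)

variable [CompleteSpace H]

theorem StronglyPositive.inner_symm (hS : StronglyPositive S) (x y : H) :
    ⟪S x, y⟫_ℝ = ⟪S y, x⟫_ℝ := by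
  rw [real_inner_comm, ← ContinuousLinearMap.adjoint_inner_left, hS.selfAdjoint.adjoint_eq]

theorem StronglyPositive.inner_nonneg (hS : StronglyPositive S) (x : H) : 0 ≤ ⟪S x, x⟫_ℝ := by
  obtain ⟨c, hc, h⟩ := hS.stronglyMonotone
  exact (by positivity : 0 ≤ c * ‖x‖ ^ 2).trans (h x)

theorem StronglyPositive.normWrt_sq (hS : StronglyPositive S) (x : H) :
    normWrt S x ^ 2 = ⟪S x, x⟫_ℝ := Real.sq_sqrt (hS.inner_nonneg x)

theorem StronglyPositive.normWrt_map (hS : StronglyPositive S) (x : H) :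
    normWrt S.inverse (S x) = normWrt S x := by
  simp only [normWrt, hS.isInvertible.inverse_apply_self]
  rw [real_inner_comm]

theorem StronglyPositive.inner_map_le (hS : StronglyPositive S) (x y : H) :
    ⟪S x, y⟫_ℝ ≤ normWrt S x * normWrt S y := by
  refine le_of_sq_le_sq ?_ (mul_nonneg (normWrt_nonneg S x) (normWrt_nonneg S y))
  have key := discrim_le_zero (a := ⟪S x, x⟫_ℝ) (b := 2 * ⟪S x, y⟫_ℝ) (c := ⟪S y, y⟫_ℝ) fun r => by
    have h := hS.inner_nonneg (r • x + y)
    simp only [map_add, map_smul, inner_add_left, inner_add_right, real_inner_smul_left,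
      real_inner_smul_right, hS.inner_symm y x] at h
    linarith
  rw [discrim] at key
  rw [mul_pow, hS.normWrt_sq, hS.normWrt_sq]
  linarith

/-- The norms `‖·‖_{S⁻¹}` and `‖·‖_S` are in duality. -/
theorem StronglyPositive.inner_le (hS : StronglyPositive S) (v x : H) :
    ⟪v, x⟫_ℝ ≤ normWrt S.inverse v * normWrt S x := by
  rw [← hS.isInvertible.self_apply_inverse v, hS.normWrt_map]
  exact hS.inner_map_le _ x

theorem StronglyPositive.abs_inner_le (hS : StronglyPositive S) (v x : H) :
    |⟪v, x⟫_ℝ| ≤ normWrt S.inverse v * normWrt S x := by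
  refine abs_le.2 ⟨?_, hS.inner_le v x⟩
  have h := hS.inner_le v (-x)
  rw [inner_neg_right, normWrt_neg] at h
  linarith

theorem StronglyPositive.normWrt_add_le (hS : StronglyPositive S) (x y : H) :
    normWrt S (x + y) ≤ normWrt S x + normWrt S y := by
  refine le_of_sq_le_sq ?_ (add_nonneg (normWrt_nonneg S x) (normWrt_nonneg S y))
  have h := hS.inner_map_le x y
  rw [hS.normWrt_sq, add_sq, hS.normWrt_sq, hS.normWrt_sq]
  simp only [map_add, inner_add_left, inner_add_right, hS.inner_symm y x]
  linarith

theorem StronglyPositive.exists_norm_le (hS : StronglyPositive S) :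
    ∃ K : ℝ, 0 ≤ K ∧ ∀ x : H, ‖x‖ ≤ K * normWrt S x := by
  obtain ⟨c, hc, h⟩ := hS.stronglyMonotone
  refine ⟨(√c)⁻¹, by positivity, fun x => ?_⟩
  rw [inv_mul_eq_div, le_div_iff₀ (by positivity), normWrt]
  refine Real.le_sqrt_of_sq_le ?_
  rw [mul_pow, Real.sq_sqrt hc.le, mul_comm]
  exact h x

theorem StronglyPositive.norm_le_inverse (hS : StronglyPositive S) (v : H) :
    ‖v‖ ≤ √‖S‖ * normWrt S.inverse v := by
  rcases eq_or_ne v 0 with rfl | hv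
  · simp [normWrt]
  -- Pairing `v` with itself in the duality avoids any estimate of the operator norm of the inverse.
  have h := hS.inner_le v v
  rw [real_inner_self_eq_norm_sq] at h
  have h2 := mul_le_mul_of_nonneg_left (normWrt_le S v) (normWrt_nonneg S.inverse v)
  have hv' : 0 < ‖v‖ := norm_pos_iff.2 hv
  nlinarith

theorem StronglyPositive.exists_norm_sub_le (hS : StronglyPositive S) {T : H → H} {L : ℝ}
    (hL : 0 ≤ L) (hT : LipschitzWrt S L T) :
    ∃ K : ℝ, 0 ≤ K ∧ ∀ x y : H, ‖T x - T y‖ ≤ K * ‖x - y‖ := by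
  refine ⟨√‖S‖ * (L * √‖S‖), by positivity, fun x y => ?_⟩
  calc ‖T x - T y‖ ≤ √‖S‖ * normWrt S.inverse (T x - T y) := hS.norm_le_inverse _
    _ ≤ √‖S‖ * (L * (√‖S‖ * ‖x - y‖)) := by
        gcongr
        exact (hT x y).trans (mul_le_mul_of_nonneg_left (normWrt_le S _) hL)
    _ = _ := by ring

theorem CocoerciveWrt.lipschitzWrt (hS : StronglyPositive S) {β : ℝ} (hβ : 0 < β) {C : H → H}
    (hC : CocoerciveWrt S β⁻¹ C) : LipschitzWrt S β C := by
  intro x y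
  have h := (hC x y).trans (hS.inner_le _ _)
  have h0 := normWrt_nonneg S.inverse (C x - C y)
  have h1 := normWrt_nonneg S (x - y)
  rw [inv_mul_le_iff₀ hβ] at h
  by_contra! hlt
  have hpos : 0 < normWrt S.inverse (C x - C y) := (mul_nonneg hβ.le h1).trans_lt hlt
  nlinarith

end SNorm

end MonotoneSplitting

namespace MonotoneSplitting

/-! ### Minty's theorem and weak-strong closedness of the graph of `A + F`. -/

section Minty

variable {H : Type*} [NormedAddCommGroup H] [InnerProductSpace ℝ H]

/-- Monotonicity says that `⟪y, q.2⟫ + ⟪q.1, v⟫ - s` is at most `⟪q.1, q.2⟫` at lifted points. It is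
affine in `(y, v, s)` and in the lifted `q` separately, so the bound passes to the hull in one
argument and then in the other. On the diagonal it reads `2⟪y, v⟫ - s ≤ s`. -/
theorem inner_le_of_mem_convexHull {G : Set (H × H)}
    (hG : ∀ p ∈ G, ∀ q ∈ G, 0 ≤ ⟪p.2 - q.2, p.1 - q.1⟫_ℝ) {y v : H} {s : ℝ}
    (h : (y, v, s) ∈ convexHull ℝ ((fun p : H × H => (p.1, p.2, ⟪p.1, p.2⟫_ℝ)) '' G)) :
    ⟪y, v⟫_ℝ ≤ s := by
  have step1 : ∀ q ∈ G, ∀ z ∈ convexHull ℝ ((fun p : H × H => (p.1, p.2, ⟪p.1, p.2⟫_ℝ)) '' G),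
      ⟪z.1, q.2⟫_ℝ + ⟪q.1, z.2.1⟫_ℝ - z.2.2 ≤ ⟪q.1, q.2⟫_ℝ := by
    intro q hq
    refine fun z hz => convexHull_min (t := {z : H × H × ℝ |
      ⟪z.1, q.2⟫_ℝ + ⟪q.1, z.2.1⟫_ℝ - z.2.2 ≤ ⟪q.1, q.2⟫_ℝ}) ?_ ?_ hz
    · rintro _ ⟨p, hp, rfl⟩
      have := hG p hp q hq
      simp only [inner_sub_left, inner_sub_right, real_inner_comm] at this
      simp only [Set.mem_ofPred_eq]
      linarith [real_inner_comm p.1 p.2, real_inner_comm q.1 q.2, real_inner_comm p.1 q.2,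
        real_inner_comm q.1 p.2]
    · intro a ha b hb r t hr ht hrt
      simp only [Set.mem_ofPred_eq] at ha hb ⊢
      simp only [Prod.fst_add, Prod.snd_add, Prod.smul_fst, Prod.smul_snd, inner_add_left,
        inner_add_right, real_inner_smul_left, real_inner_smul_right, smul_eq_mul]
      have e : ⟪q.1, q.2⟫_ℝ = r * ⟪q.1, q.2⟫_ℝ + t * ⟪q.1, q.2⟫_ℝ := by rw [← add_mul, hrt, one_mul]
      linarith [mul_le_mul_of_nonneg_left ha hr, mul_le_mul_of_nonneg_left hb ht]
  have step2 : ∀ z ∈ convexHull ℝ ((fun p : H × H => (p.1, p.2, ⟪p.1, p.2⟫_ℝ)) '' G),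
      ⟪y, z.2.1⟫_ℝ + ⟪z.1, v⟫_ℝ - z.2.2 ≤ s := by
    refine fun z hz => convexHull_min (t := {z : H × H × ℝ |
      ⟪y, z.2.1⟫_ℝ + ⟪z.1, v⟫_ℝ - z.2.2 ≤ s}) ?_ ?_ hz
    · rintro _ ⟨p, hp, rfl⟩
      have := step1 p hp _ h
      simp only [Set.mem_ofPred_eq] at this ⊢
      linarith
    · intro a ha b hb r t hr ht hrt
      simp only [Set.mem_ofPred_eq] at ha hb ⊢
      simp only [Prod.fst_add, Prod.snd_add, Prod.smul_fst, Prod.smul_snd, inner_add_left,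
        inner_add_right, real_inner_smul_left, real_inner_smul_right, smul_eq_mul]
      have e : s = r * s + t * s := by rw [← add_mul, hrt, one_mul]
      linarith [mul_le_mul_of_nonneg_left ha hr, mul_le_mul_of_nonneg_left hb ht]
  have := step2 _ h
  simp only at this
  linarith

/-- A concave quadratic `σ - ‖w‖² / 4` bounded above on a nonempty convex set satisfies the
first-order optimality condition at the (generalized) maximizer. -/
theorem exists_le_of_convex_of_bddAbove [CompleteSpace H] {K : Set (H × ℝ)} (hK : Convex ℝ K)
    (hne : K.Nonempty) (hbd : ∀ p ∈ K, p.2 ≤ ‖p.1‖ ^ 2 / 4) :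
    ∃ x : H, ∀ p ∈ K, ‖x‖ ^ 2 + ⟪x, p.1⟫_ℝ + p.2 ≤ 0 := by
  set h : H × ℝ → ℝ := fun p => p.2 - ‖p.1‖ ^ 2 / 4 with hh
  have hcont : Continuous h := by fun_prop
  have hbdd : BddAbove (h '' K) := ⟨0, by rintro _ ⟨p, hp, rfl⟩; exact sub_nonpos.2 (hbd p hp)⟩
  set m := sSup (h '' K) with hm
  have hle : ∀ p ∈ K, h p ≤ m := fun p hp => le_csSup hbdd ⟨p, hp, rfl⟩
  have hm0 : m ≤ 0 := csSup_le (hne.image h) (by rintro _ ⟨p, hp, rfl⟩; exact sub_nonpos.2 (hbd p hp))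
  have hseq : ∀ n : ℕ, ∃ p ∈ K, m - 1 / (n + 1 : ℝ) < h p := fun n => by
    obtain ⟨_, ⟨p, hp, rfl⟩, hlt⟩ := exists_lt_of_lt_csSup (hne.image h)
      (show m - 1 / (n + 1 : ℝ) < m by linarith [Nat.one_div_pos_of_nat (α := ℝ) (n := n)])
    exact ⟨p, hp, hlt⟩
  choose p hpK hp using hseq
  -- By the parallelogram law, the midpoint value of `h` exceeds the average by `‖a.1 - b.1‖ ^ 2 /
  -- 16` and is still at most `m`; maximizing sequences are therefore Cauchy in the first component.
  have hdist : ∀ a ∈ K, ∀ b ∈ K, ‖a.1 - b.1‖ ^ 2 ≤ 8 * ((m - h a) + (m - h b)) := by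
    intro a ha b hb
    have hmid := hle _ (hK ha hb (by norm_num : (0 : ℝ) ≤ 1 / 2) (by norm_num : (0 : ℝ) ≤ 1 / 2)
      (by norm_num))
    simp only [hh, Prod.fst_add, Prod.snd_add, Prod.smul_fst, Prod.smul_snd, smul_eq_mul,
      ← smul_add, norm_smul, mul_pow] at hmid ⊢
    rw [norm_add_sq_real] at hmid
    rw [norm_sub_sq_real]
    norm_num at hmid
    linarith
  have hlim0 : Tendsto (fun n : ℕ => 1 / ((n : ℝ) + 1)) atTop (𝓝 0) :=
    tendsto_one_div_add_atTop_nhds_zero_nat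
  have hcau : CauchySeq fun n => (p n).1 := by
    refine cauchySeq_of_le_tendsto_0' (fun n : ℕ => √(16 * (1 / ((n : ℝ) + 1)))) ?_ ?_
    · intro n k hnk
      rw [dist_eq_norm]
      refine Real.le_sqrt_of_sq_le ((hdist _ (hpK n) _ (hpK k)).trans ?_)
      have h1 : 1 / ((k : ℝ) + 1) ≤ 1 / ((n : ℝ) + 1) := Nat.one_div_le_one_div hnk
      linarith [hp n, hp k]
    · have := (hlim0.const_mul 16).sqrt
      simpa using this
  obtain ⟨w, hw⟩ := cauchySeq_tendsto_of_complete hcau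
  have hhp : Tendsto (fun n => h (p n)) atTop (𝓝 m) := by
    refine tendsto_of_tendsto_of_tendsto_of_le_of_le (by simpa using hlim0.const_sub m)
      tendsto_const_nhds (fun n => (hp n).le) fun n => hle _ (hpK n)
  have hσ : Tendsto (fun n => (p n).2) atTop (𝓝 (m + ‖w‖ ^ 2 / 4)) := by
    refine (hhp.add ((hw.norm.pow 2).div_const 4)).congr fun n => ?_
    simp [hh]
  refine ⟨-(1 / 2 : ℝ) • w, fun q hq => ?_⟩
  -- The limit point need not lie in `K`, so the segment towards `q` is obtained as a limit of
  -- segments starting at `p n`. Dividing by `t` and letting `t → 0` gives the first-order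
  -- condition.
  have hvar : ∀ t : ℝ, 0 < t → t ≤ 1 →
      q.2 - (m + ‖w‖ ^ 2 / 4) - ⟪w, q.1 - w⟫_ℝ / 2 - t * (‖q.1 - w‖ ^ 2 / 4) ≤ 0 := by
    intro t ht ht1
    have hlim : h ((1 - t) • (w, m + ‖w‖ ^ 2 / 4) + t • q) ≤ m := by
      refine le_of_tendsto ((hcont.tendsto _).comp
        (((hw.prodMk_nhds hσ).const_smul (1 - t)).add_const (t • q))) (Eventually.of_forall ?_)
      exact fun n => hle _ (hK (hpK n) hq (by linarith) ht.le (by ring))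
    have e : (1 - t) • w + t • q.1 = w + t • (q.1 - w) := by module
    simp only [hh, Prod.fst_add, Prod.snd_add, Prod.smul_fst, Prod.smul_snd, smul_eq_mul, e] at hlim
    rw [norm_add_sq_real, real_inner_smul_right, norm_smul, mul_pow, Real.norm_eq_abs,
      sq_abs] at hlim
    refine le_of_mul_le_mul_left ?_ ht
    linarith
  have h0 : q.2 - (m + ‖w‖ ^ 2 / 4) - ⟪w, q.1 - w⟫_ℝ / 2 ≤ 0 := by
    have ht : Tendsto (fun t : ℝ =>
        q.2 - (m + ‖w‖ ^ 2 / 4) - ⟪w, q.1 - w⟫_ℝ / 2 - t * (‖q.1 - w‖ ^ 2 / 4)) (𝓝[>] 0)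
        (𝓝 (q.2 - (m + ‖w‖ ^ 2 / 4) - ⟪w, q.1 - w⟫_ℝ / 2 - 0 * (‖q.1 - w‖ ^ 2 / 4))) :=
      (Continuous.tendsto (by fun_prop) 0).mono_left nhdsWithin_le_nhds
    have := le_of_tendsto ht (by
      filter_upwards [Ioc_mem_nhdsGT (zero_lt_one' ℝ)] with t ht using hvar t ht.1 ht.2)
    simpa using this
  rw [inner_sub_right, real_inner_self_eq_norm_sq] at h0
  rw [norm_smul, mul_pow, real_inner_smul_left]
  norm_num
  linarith

/-- The one-point extension property of monotone sets behind Minty's theorem. -/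
theorem exists_inner_nonpos_of_monotone [CompleteSpace H] {G : Set (H × H)}
    (hG : ∀ p ∈ G, ∀ q ∈ G, 0 ≤ ⟪p.2 - q.2, p.1 - q.1⟫_ℝ) :
    ∃ x : H, ∀ p ∈ G, ⟪x + p.2, x - p.1⟫_ℝ ≤ 0 := by
  rcases G.eq_empty_or_nonempty with rfl | hne
  · exact ⟨0, by simp⟩
  set Q : Set (H × H × ℝ) := convexHull ℝ ((fun p : H × H => (p.1, p.2, ⟪p.1, p.2⟫_ℝ)) '' G)
  -- Chosen because `⟪x + v, x - y⟫ = ‖x‖ ^ 2 + ⟪x, v - y⟫ - ⟪y, v⟫`; the required upper bound is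
  -- `-⟪y, v⟫ ≤ ‖v - y‖ ^ 2 / 4`.
  let f : H × H × ℝ →ₗ[ℝ] H × ℝ :=
    { toFun := fun z => (z.2.1 - z.1, -z.2.2)
      map_add' := fun a b => by ext <;> simp <;> abel
      map_smul' := fun r a => by ext <;> simp [smul_sub] }
  have hQ : Convex ℝ (f '' Q) := (convex_convexHull ℝ _).linear_image f
  obtain ⟨x, hx⟩ := exists_le_of_convex_of_bddAbove hQ
    ((hne.image _).convexHull.image f) (by
      rintro _ ⟨⟨y, v, s⟩, hz, rfl⟩
      have := inner_le_of_mem_convexHull hG hz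
      have h2 := sq_nonneg ‖v + y‖
      simp only [f, LinearMap.coe_mk, AddHom.coe_mk]
      rw [norm_sub_sq_real]
      rw [norm_add_sq_real] at h2
      rw [real_inner_comm] at h2 ⊢
      linarith)
  refine ⟨x, fun p hp => ?_⟩
  have := hx _ ⟨_, subset_convexHull ℝ _ ⟨p, hp, rfl⟩, rfl⟩
  simp only [f, LinearMap.coe_mk, AddHom.coe_mk, inner_sub_right] at this
  simp only [inner_add_left, inner_sub_right, real_inner_self_eq_norm_sq]
  linarith [real_inner_comm p.1 p.2, real_inner_comm x p.2]

theorem MaximallyMonotone.monotone {A : H → Set H} (hA : MaximallyMonotone A) {x y u v : H}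
    (hu : u ∈ A x) (hv : v ∈ A y) : 0 ≤ ⟪u - v, x - y⟫_ℝ :=
  (hA x u).1 hu y v hv

/-- Minty's theorem: the resolvents of a maximally monotone operator have full domain. -/
theorem MaximallyMonotone.exists_resolvent [CompleteSpace H] {A : H → Set H}
    (hA : MaximallyMonotone A) {r : ℝ} (hr : 0 < r) (p : H) :
    ∃ y, r⁻¹ • (p - y) ∈ A y := by
  obtain ⟨x, hx⟩ := exists_inner_nonpos_of_monotone
    (G := {q : H × H | ∃ y, ∃ v ∈ A y, q = (y - p, r • v)}) (by
      rintro _ ⟨y, v, hv, rfl⟩ _ ⟨y', v', hv', rfl⟩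
      simp only [sub_sub_sub_cancel_right, ← smul_sub, real_inner_smul_left]
      exact mul_nonneg hr.le (hA.monotone hv hv'))
  refine ⟨x + p, (hA _ _).2 fun y v hv => ?_⟩
  have h := hx _ ⟨y, v, hv, rfl⟩
  simp only at h
  have e : r⁻¹ • (p - (x + p)) - v = -(r⁻¹ • (x + r • v)) := by
    rw [smul_add, inv_smul_smul₀ hr.ne']; module
  have e2 : x + p - y = x - (y - p) := by abel
  rw [e, e2, inner_neg_left, real_inner_smul_left]
  have := mul_nonpos_of_nonneg_of_nonpos (inv_pos.2 hr).le h
  linarith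

/-- The resolvents of `A + F` have full domain when `A` is maximally monotone, `F` is Lipschitz and
the step is small. -/
theorem MaximallyMonotone.exists_resolvent_add [CompleteSpace H] {A : H → Set H}
    (hA : MaximallyMonotone A) {F : H → H} {K : ℝ} (hK : 0 ≤ K)
    (hF : ∀ x y, ‖F x - F y‖ ≤ K * ‖x - y‖) (p : H) :
    ∃ r : ℝ, 0 < r ∧ ∃ y, r⁻¹ • (p - y) - F y ∈ A y := by
  set r : ℝ := (2 * (K + 1))⁻¹ with hr
  have hr0 : 0 < r := by positivity
  have hrK : r * K ≤ 1 / 2 := by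
    rw [hr, inv_mul_le_iff₀ (by positivity)]; linarith
  refine ⟨r, hr0, ?_⟩
  choose J hJ using hA.exists_resolvent hr0
  have hJn : ∀ a b, ‖J a - J b‖ ≤ ‖a - b‖ := by
    intro a b
    have h := hA.monotone (hJ a) (hJ b)
    rw [← smul_sub, real_inner_smul_left] at h
    have h1 := nonneg_of_mul_nonneg_right h (inv_pos.2 hr0)
    have e : a - J a - (b - J b) = (a - b) - (J a - J b) := by abel
    rw [e, inner_sub_left, real_inner_self_eq_norm_sq] at h1
    have h2 := real_inner_le_norm (a - b) (J a - J b)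
    by_contra! hlt
    have h3 := norm_nonneg (a - b)
    nlinarith
  -- `J` is nonexpansive and `r * K ≤ 1 / 2`; a fixed point is a resolvent point of `A + F`.
  have hc : ContractingWith (1 / 2) fun y => J (p - r • F y) := by
    refine ⟨by rw [← NNReal.coe_lt_coe]; norm_num, LipschitzWith.of_dist_le_mul fun a b => ?_⟩
    rw [dist_eq_norm, dist_eq_norm]
    refine (hJn _ _).trans ?_
    rw [sub_sub_sub_cancel_left, ← smul_sub, norm_smul, Real.norm_of_nonneg hr0.le, norm_sub_rev a b]
    have := mul_le_mul_of_nonneg_left (hF b a) hr0.le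
    have h3 := mul_le_mul_of_nonneg_right hrK (norm_nonneg (b - a))
    push_cast
    linarith
  have hfix : J (p - r • F hc.fixedPoint) = hc.fixedPoint := hc.fixedPoint_isFixedPt
  refine ⟨hc.fixedPoint, ?_⟩
  have h := hJ (p - r • F hc.fixedPoint)
  rw [hfix, sub_right_comm, smul_sub _ (p - _), inv_smul_smul₀ hr0.ne'] at h
  exact h

/-- The graph of `A + F` is closed for the weak topology on bounded sets in the domain and the
strong topology in the range. -/
theorem MaximallyMonotone.neg_mem_of_tendsto [CompleteSpace H] {A : H → Set H}
    (hA : MaximallyMonotone A) {F : H → H} {K : ℝ} (hK : 0 ≤ K)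
    (hF : ∀ x y, ‖F x - F y‖ ≤ K * ‖x - y‖) (hFm : MonotoneOp F)
    {ι : Type*} {l : Filter ι} [l.NeBot] {x a : ι → H} {p : H}
    (hx : ∀ w, Tendsto (fun i => ⟪w, x i⟫_ℝ) l (𝓝 ⟪w, p⟫_ℝ)) {R : ℝ} (hR : ∀ i, ‖x i‖ ≤ R)
    (ha : ∀ i, a i ∈ A (x i)) (hlim : Tendsto (fun i => a i + F (x i)) l (𝓝 0)) :
    -F p ∈ A p := by
  obtain ⟨r, hr, y, hy⟩ := hA.exists_resolvent_add hK hF p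
  set q := r⁻¹ • (p - y) with hq
  -- Adding the monotonicity of `A` and `F` leaves a pairing with the fixed vector `q`, to which
  -- weak convergence applies. The limit `⟪q, p - y⟫ ≤ 0` forces `p = y`, hence `q = 0`.
  have h1 : ∀ i, ⟪q, x i⟫_ℝ - ⟪q, y⟫_ℝ ≤ ‖a i + F (x i)‖ * (R + ‖y‖) := by
    intro i
    have e := hA.monotone (ha i) hy
    have e2 := hFm (x i) y
    have e3 : ⟪a i + F (x i), x i - y⟫_ℝ ≤ ‖a i + F (x i)‖ * (R + ‖y‖) := by
      refine (real_inner_le_norm _ _).trans ?_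
      gcongr
      exact (norm_sub_le _ _).trans (by linarith [hR i])
    simp only [inner_sub_left, inner_add_left, inner_sub_right] at e e2 e3
    linarith
  have h2 : ⟪q, p⟫_ℝ - ⟪q, y⟫_ℝ ≤ ‖(0 : H)‖ * (R + ‖y‖) :=
    le_of_tendsto_of_tendsto' ((hx q).sub_const _) (hlim.norm.mul_const _) h1
  rw [norm_zero, zero_mul, ← inner_sub_right, hq, real_inner_smul_left,
    real_inner_self_eq_norm_sq] at h2
  have h3 : ‖p - y‖ ^ 2 ≤ 0 := by
    by_contra! hlt
    have := mul_pos (inv_pos.2 hr) hlt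
    linarith
  have h4 : p - y = 0 := by
    rw [← norm_eq_zero]
    exact pow_eq_zero_iff two_ne_zero |>.1 (le_antisymm h3 (sq_nonneg _))
  rw [hq, h4, smul_zero, zero_sub] at hy
  rwa [← sub_eq_zero.1 h4] at hy

end Minty

end MonotoneSplitting

namespace MonotoneSplitting

/-! ### Descent and coercivity of the Lyapunov function. -/

section Energy

variable {H : Type*} [NormedAddCommGroup H] [InnerProductSpace ℝ H]

/-- The Lyapunov function of the splitting method, where `d`, `d'` are the last two increments of
the iterates, `r` is the distance vector to a zero, `u`, `u'` are the last two momentum terms and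
`b` is the variation of the forward operator `B`. -/
noncomputable def energy (S : H →L[ℝ] H) (γ μ β l l' : ℝ) (d d' r u u' b : H) : ℝ :=
  normWrt S r ^ 2 + 2 * ⟪u, r⟫_ℝ + 2 * γ * ⟪b, d⟫_ℝ + normWrt S d ^ 2 + 2 * ⟪u - u', d⟫_ℝ
    + (3 * l + γ * β + γ * μ * (√2 + 1)) * normWrt S d ^ 2 + l' * normWrt S d' ^ 2
    + γ * μ * normWrt S (d - d') ^ 2

variable [CompleteSpace H] {S : H →L[ℝ] H}

theorem StronglyPositive.two_mul_abs_inner_le (hS : StronglyPositive S) {v p : H} {l : ℝ}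
    (hl : 0 ≤ l) (h : normWrt S.inverse v ≤ l * normWrt S p) (q : H) :
    2 * |⟪v, q⟫_ℝ| ≤ l * (normWrt S p ^ 2 + normWrt S q ^ 2) := by
  have h1 := hS.abs_inner_le v q
  have h2 := mul_le_mul_of_nonneg_right h (normWrt_nonneg S q)
  have h3 := mul_nonneg hl (sq_nonneg (normWrt S p - normWrt S q))
  linarith

/-- Twice `hz`, twice `hm` and `2γ` times `hB` are added: the `S` terms telescope by polarization,
and the `B` terms leave only `-2γ⟪b₂ - b₁, d₃ - d₂⟫`. The weight `3 * l` pays for two Young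
estimates and the next `l'` term. Likewise `5/2` is `1/2` from cocoercivity, `1` from the variation
of `C`, and `1` stored in the next energy. -/
theorem energy_le (hS : StronglyPositive S) {γ μ β l₀ l₁ l₂ : ℝ} {d₁ d₂ d₃ r u₁ u₂ u₃ b₁ b₂ c c' : H}
    (hγ : 0 < γ) (hμ : 0 ≤ μ) (hβ : 0 < β) (hl₀ : 0 ≤ l₀) (hl₁ : 0 ≤ l₁)
    (hz : 0 ≤ ⟪-S d₃ - u₃ + u₂ - γ • b₂ - γ • c, r + d₃⟫_ℝ)
    (hm : 0 ≤ ⟪-S d₃ + S d₂ - u₃ + (2 : ℝ) • u₂ - u₁ - γ • (b₂ - b₁) - γ • c', d₃⟫_ℝ)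
    (hB : 0 ≤ ⟪b₂, r + d₂⟫_ℝ)
    (hBL : normWrt S.inverse (b₂ - b₁) ≤ μ * normWrt S (d₂ + (d₂ - d₁)))
    (hC : β⁻¹ * normWrt S.inverse c ^ 2 ≤ ⟪c, r⟫_ℝ)
    (hCL : normWrt S.inverse c' ≤ β * normWrt S d₂)
    (hu₁ : normWrt S.inverse u₁ ≤ l₀ * normWrt S d₁)
    (hu₂ : normWrt S.inverse u₂ ≤ l₁ * normWrt S d₂) :
    energy S γ μ β l₂ l₁ d₃ d₂ (r + d₃) u₃ u₂ b₂
      + (1 - 3 * l₂ - l₁ - 5 / 2 * (γ * β) - γ * μ * (√2 + 1)) * normWrt S d₃ ^ 2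
      + (1 - l₁ - l₀ - γ * μ * (√2 + 1)) * normWrt S (d₃ - d₂) ^ 2
      ≤ energy S γ μ β l₁ l₀ d₂ d₁ r u₂ u₁ b₁ := by
  have k1 := (mul_le_mul_of_nonneg_left (le_abs_self _) zero_le_two).trans
    (hS.two_mul_abs_inner_le hl₁ hu₂ d₃)
  have k2 := (mul_le_mul_of_nonneg_left (le_abs_self _) zero_le_two).trans
    (hS.two_mul_abs_inner_le hl₁ hu₂ (d₃ - d₂))
  have k3 := (mul_le_mul_of_nonneg_left (neg_le_abs _) zero_le_two).trans
    (hS.two_mul_abs_inner_le hl₀ hu₁ (d₃ - d₂))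
  have k4 := mul_le_mul_of_nonneg_left ((mul_le_mul_of_nonneg_left (neg_le_abs _)
    zero_le_two).trans (hS.two_mul_abs_inner_le hβ.le hCL d₃)) hγ.le
  have k5 : -2 * γ * ⟪c, r⟫_ℝ - 2 * γ * ⟪c, d₃⟫_ℝ ≤ γ * β / 2 * normWrt S d₃ ^ 2 := by
    have h1 := mul_le_mul_of_nonneg_left ((neg_le_abs _).trans (hS.abs_inner_le c d₃)) hγ.le
    have h2 := mul_le_mul_of_nonneg_left hC hγ.le
    -- Completing this square uses up the whole cocoercivity term.
    have h3 : 0 ≤ γ * (β⁻¹ * (2 * normWrt S.inverse c - β * normWrt S d₃) ^ 2) := by positivity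
    have e : γ * (β⁻¹ * (2 * normWrt S.inverse c - β * normWrt S d₃) ^ 2)
        = 4 * (γ * (β⁻¹ * normWrt S.inverse c ^ 2))
          - 4 * (γ * (normWrt S.inverse c * normWrt S d₃)) + γ * β * normWrt S d₃ ^ 2 := by
      field_simp
      ring
    linarith
  have k6 : -2 * γ * ⟪b₂ - b₁, d₃ - d₂⟫_ℝ ≤ γ * μ * ((√2 + 1) * normWrt S d₂ ^ 2
      + √2 * normWrt S (d₃ - d₂) ^ 2 + normWrt S (d₂ - d₁) ^ 2) := by
    have h1 := (neg_le_abs _).trans (hS.abs_inner_le (b₂ - b₁) (d₃ - d₂))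
    have h2 := mul_le_mul_of_nonneg_right (hBL.trans
      (mul_le_mul_of_nonneg_left (hS.normWrt_add_le d₂ (d₂ - d₁)) hμ))
      (normWrt_nonneg S (d₃ - d₂))
    have h3 := mul_le_mul_of_nonneg_left (h1.trans h2) hγ.le
    set p := normWrt S d₂
    set q := normWrt S (d₃ - d₂)
    set s := normWrt S (d₂ - d₁)
    have hs2 : √2 * √2 = 2 := Real.mul_self_sqrt (by norm_num)
    -- Young's inequality for `p * q` with the reciprocal weights `√2 + 1` and `√2 - 1`, and with
    -- unit weights for `s * q`.
    have h4 : 2 * ((p + s) * q) ≤ (√2 + 1) * p ^ 2 + √2 * q ^ 2 + s ^ 2 := by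
      have h5 : 0 ≤ (√2 - 1) * ((√2 + 1) * p - q) ^ 2 :=
        mul_nonneg (sub_nonneg.2 (Real.one_le_sqrt.2 one_le_two)) (sq_nonneg _)
      have e : (√2 - 1) * ((√2 + 1) * p - q) ^ 2
          = (√2 + 1) * p ^ 2 - 2 * (p * q) + (√2 - 1) * q ^ 2 := by
        linear_combination ((√2 + 1) * p ^ 2 - 2 * (p * q)) * hs2
      linarith [sq_nonneg (s - q)]
    have h6 := mul_le_mul_of_nonneg_left h4 (mul_nonneg hγ.le hμ)
    linarith
  have hB' := mul_nonneg hγ.le hB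
  have s1 := hS.inner_symm d₂ d₃
  have s2 := hS.inner_symm r d₃
  simp only [energy, hS.normWrt_sq, map_add, map_sub, inner_add_left, inner_sub_left,
    inner_neg_left, real_inner_smul_left, inner_add_right, inner_sub_right] at *
  linarith

/-- Young's inequality on each pairing: the stored multiples of the squared increments absorb all
negative terms except those in `normWrt S r ^ 2`, whose coefficient remains at least `ε`. -/
theorem le_energy (hS : StronglyPositive S) {γ μ β l l' ε : ℝ} {d d' r u u' b : H}
    (hγ : 0 < γ) (hμ : 0 ≤ μ) (hβ : 0 < β) (hl : 0 ≤ l) (hl' : 0 ≤ l') (hl1 : l' ≤ 1)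
    (hε : ε ≤ 1 - l - l' - γ * μ * (√2 + 1))
    (hu : normWrt S.inverse u ≤ l * normWrt S d) (hu' : normWrt S.inverse u' ≤ l' * normWrt S d')
    (hb : normWrt S.inverse b ≤ μ * normWrt S (r - (d - d'))) :
    ε * normWrt S r ^ 2 ≤ energy S γ μ β l l' d d' r u u' b := by
  have k1 := (mul_le_mul_of_nonneg_left (neg_le_abs _) zero_le_two).trans
    (hS.two_mul_abs_inner_le hl hu r)
  have k2 := (mul_le_mul_of_nonneg_left (neg_le_abs _) zero_le_two).trans
    (hS.two_mul_abs_inner_le hl hu d)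
  have k3 := (mul_le_mul_of_nonneg_left (le_abs_self _) zero_le_two).trans
    (hS.two_mul_abs_inner_le hl' hu' d)
  have hadd := hS.normWrt_add_le r (-(d - d'))
  rw [normWrt_neg, ← sub_eq_add_neg] at hadd
  have h1 := (neg_le_abs _).trans (hS.abs_inner_le b d)
  have h2 := mul_le_mul_of_nonneg_right (hb.trans (mul_le_mul_of_nonneg_left hadd hμ))
    (normWrt_nonneg S d)
  have h3 := mul_le_mul_of_nonneg_left (h1.trans h2) hγ.le
  have hγμ := mul_nonneg hγ.le hμ
  have h4 := mul_nonneg hγμ (sq_nonneg (normWrt S r - normWrt S d))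
  have h5 := mul_nonneg hγμ (sq_nonneg (normWrt S (d - d') - normWrt S d))
  have hs : 0 ≤ √2 - 1 := sub_nonneg.2 (Real.one_le_sqrt.2 one_le_two)
  have h6 : 0 ≤ (1 - l' + γ * β + γ * μ * (√2 - 1)) * normWrt S d ^ 2 := by
    have : 0 ≤ 1 - l' := by linarith
    positivity
  have h7 : 0 ≤ (1 - l - l' - γ * μ * (√2 + 1) - ε) * normWrt S r ^ 2 :=
    mul_nonneg (by linarith) (sq_nonneg _)
  have h8 : 0 ≤ (l' + γ * μ * √2) * normWrt S r ^ 2 := by positivity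
  simp only [energy, inner_sub_left]
  linarith

end Energy

end MonotoneSplitting

namespace MonotoneSplitting

/-! ### Weak limits along ultrafilters and Opial's lemma. -/

section WeakConvergence

variable {H : Type*} [NormedAddCommGroup H] [InnerProductSpace ℝ H]

theorem tendsto_inner_zero {ι : Type*} {l : Filter ι} {a b : ι → H} {R : ℝ}
    (ha : Tendsto a l (𝓝 0)) (hb : ∀ᶠ i in l, ‖b i‖ ≤ R) :
    Tendsto (fun i => ⟪a i, b i⟫_ℝ) l (𝓝 0) := by
  refine squeeze_zero_norm' (a := fun i => ‖a i‖ * R) ?_ (by simpa using ha.norm.mul_const R)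
  filter_upwards [hb] with i hi
  exact (norm_inner_le_norm _ _).trans (mul_le_mul_of_nonneg_left hi (norm_nonneg _))

variable [CompleteSpace H]

/-- Bounded families converge weakly along ultrafilters. -/
theorem exists_weak_limit_of_ultrafilter {ι : Type*} (F : Ultrafilter ι) {x : ι → H} {R : ℝ}
    (hR : ∀ i, ‖x i‖ ≤ R) :
    ∃ p : H, ∀ w, Tendsto (fun i => ⟪w, x i⟫_ℝ) F (𝓝 ⟪w, p⟫_ℝ) := by
  let g : ι → WeakDual ℝ H := fun i => StrongDual.toWeakDual (InnerProductSpace.toDual ℝ H (x i))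
  obtain ⟨f, -, hf⟩ := (WeakDual.isCompact_closedBall (0 : StrongDual ℝ H) R).ultrafilter_le_nhds
    (F.map g) (by
      rw [Ultrafilter.coe_map, le_principal_iff]
      refine mem_map.2 (univ_mem' fun i => ?_)
      simpa [g] using hR i)
  refine ⟨(InnerProductSpace.toDual ℝ H).symm (WeakDual.toStrongDual f), fun w => ?_⟩
  have h := ((WeakDual.eval_continuous (𝕜 := ℝ) w).tendsto f).comp hf
  rw [real_inner_comm, InnerProductSpace.toDual_symm_apply]
  refine Tendsto.congr (fun i => ?_) h
  simp [g, real_inner_comm]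

/-- Opial's lemma for the norm `‖·‖_S`. -/
theorem StronglyPositive.exists_tendsto_weak {S : H →L[ℝ] H} (hS : StronglyPositive S)
    {Z : Set H} {x : ℕ → H} {R : ℝ} (hR : ∀ k, ‖x k‖ ≤ R)
    (hlim : ∀ z ∈ Z, ∃ m, Tendsto (fun k => normWrt S (x k - z) ^ 2) atTop (𝓝 m))
    (hcl : ∀ F : Ultrafilter ℕ, ↑F ≤ (atTop : Filter ℕ) → ∀ p,
      (∀ w, Tendsto (fun k => ⟪w, x k⟫_ℝ) F (𝓝 ⟪w, p⟫_ℝ)) → p ∈ Z) :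
    ∃ p ∈ Z, Tendsto (fun k => toWeakSpace ℝ H (x k)) atTop (𝓝 (toWeakSpace ℝ H p)) := by
  have huniq : ∀ F G : Ultrafilter ℕ, ↑F ≤ (atTop : Filter ℕ) → ↑G ≤ (atTop : Filter ℕ) → ∀ p q,
      (∀ w, Tendsto (fun k => ⟪w, x k⟫_ℝ) F (𝓝 ⟪w, p⟫_ℝ)) →
      (∀ w, Tendsto (fun k => ⟪w, x k⟫_ℝ) G (𝓝 ⟪w, q⟫_ℝ)) → p = q := by
    intro F G hF hG p q hp hq
    obtain ⟨m₁, h₁⟩ := hlim p (hcl F hF p hp)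
    obtain ⟨m₂, h₂⟩ := hlim q (hcl G hG q hq)
    -- Polarization: this pairing converges along the whole sequence, so its limits along `F` and
    -- `G` agree and `⟪S (p - q), p - q⟫ = 0`.
    have e : ∀ k, ⟪S (p - q), x k⟫_ℝ = (normWrt S (x k - q) ^ 2 - normWrt S (x k - p) ^ 2
        - ⟪S q, q⟫_ℝ + ⟪S p, p⟫_ℝ) / 2 := by
      intro k
      simp only [hS.normWrt_sq, map_sub, inner_sub_left, inner_sub_right, hS.inner_symm (x k)]
      ring
    have hc : ∃ m, Tendsto (fun k => ⟪S (p - q), x k⟫_ℝ) atTop (𝓝 m) := by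
      simp only [e]
      exact ⟨_, (((h₂.sub h₁).sub_const _).add_const _).div_const 2⟩
    obtain ⟨m, hm⟩ := hc
    have e1 := tendsto_nhds_unique (hm.mono_left hF) (hp _)
    have e2 := tendsto_nhds_unique (hm.mono_left hG) (hq _)
    obtain ⟨c, hc, hpos⟩ := hS.stronglyMonotone
    have h := hpos (p - q)
    rw [inner_sub_right, ← e1, ← e2, sub_self] at h
    have h0 : ‖p - q‖ ^ 2 ≤ 0 := by
      by_contra! hlt
      linarith [mul_pos hc hlt]
    exact sub_eq_zero.1 (norm_eq_zero.1
      (pow_eq_zero_iff two_ne_zero |>.1 (le_antisymm h0 (sq_nonneg _))))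
  obtain ⟨p, hp⟩ := exists_weak_limit_of_ultrafilter (Ultrafilter.of atTop) hR
  refine ⟨p, hcl _ (Ultrafilter.of_le _) p hp, ?_⟩
  have hinner : ∀ w, Tendsto (fun k => ⟪w, x k⟫_ℝ) atTop (𝓝 ⟪w, p⟫_ℝ) := by
    intro w
    refine (tendsto_iff_ultrafilter _ _ _).2 fun F hF => ?_
    obtain ⟨q, hq⟩ := exists_weak_limit_of_ultrafilter F hR
    rw [huniq _ _ (Ultrafilter.of_le _) hF p q hp hq]
    exact hq w
  refine (WeakBilin.tendsto_iff_forall_eval_tendsto (topDualPairing ℝ H).flip ?_).2 fun f => ?_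
  · intro a b hab
    exact ext_inner_left ℝ fun w => LinearMap.congr_fun hab (InnerProductSpace.toDual ℝ H w)
  · have := hinner ((InnerProductSpace.toDual ℝ H).symm f)
    simp only [InnerProductSpace.toDual_symm_apply] at this
    exact this

end WeakConvergence

/-! ### The energy along the iterates. -/

section Algorithm

variable {H : Type*} [NormedAddCommGroup H] [InnerProductSpace ℝ H]
  {A : H → Set H} {B C : H → H} {S : H →L[ℝ] H} {M : ℕ → H → H} {γ : ℝ} {xPrev : H}
  {x y u : ℕ → H}

omit [InnerProductSpace ℝ H] in
theorem mem_zer_sumOp {z : H} : z ∈ zer (sumOp A B C) ↔ -(B z + C z) ∈ A z := by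
  simp only [zer, sumOp, Set.add_singleton, Set.mem_ofPred_eq, Set.image_image, Set.mem_image]
  constructor
  · rintro ⟨a, ha, h⟩
    rwa [← eq_neg_of_add_eq_zero_left ((add_assoc _ _ _).symm.trans h)]
  · exact fun h => ⟨_, h, by abel⟩

/-- The momentum update gives `γ (M_k x_{k+1} - M_k x_k) = S (x_{k+1} - x_k) + u_{k+1}`, which
removes the kernel. -/
theorem IsNonlinearSRFBS.mem (h : IsNonlinearSRFBS A B C S M γ xPrev x y u) (hγ : 0 < γ) (k : ℕ) :
    γ⁻¹ • (-S (x (k + 1) - x k) - u (k + 1) + u k) - B (y k) - C (x k) ∈ A (x (k + 1)) := by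
  have hx := h.x_succ k
  simp only [warpedResolvent, inverseOp, Set.singleton_add, Set.mem_ofPred_eq,
    Set.mem_image] at hx
  obtain ⟨a, ha, he⟩ := hx
  convert ha using 1
  rw [← eq_sub_iff_add_eq'] at he
  rw [he, h.u_succ k, map_sub]
  have e : -(S (x (k + 1)) - S (x k)) - (γ • M k (x (k + 1)) - S (x (k + 1))
      - (γ • M k (x k) - S (x k))) + u k = γ • (M k (x k) - M k (x (k + 1))) + u k := by
    rw [smul_sub]; abel
  rw [e, smul_add, inv_smul_smul₀ hγ.ne']
  abel

theorem IsNonlinearSRFBS.momentum_le (h : IsNonlinearSRFBS A B C S M γ xPrev x y u) {L : ℕ → ℝ}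
    (hM : ∀ k, LipschitzWrt S (L k) (fun z => γ • M k z - S z)) (k : ℕ) :
    normWrt S.inverse (u (k + 1)) ≤ L k * normWrt S (x (k + 1) - x k) := by
  rw [h.u_succ k]
  exact hM k _ _

/-- The Lyapunov function evaluated along the iterates. -/
noncomputable def energySeq (S : H →L[ℝ] H) (B : H → H) (γ μ β : ℝ) (L : ℕ → ℝ) (x y u : ℕ → H)
    (z : H) (j : ℕ) : ℝ :=
  energy S γ μ β (L (j + 1)) (L j) (x (j + 2) - x (j + 1)) (x (j + 1) - x j) (x (j + 2) - z)
    (u (j + 2)) (u (j + 1)) (B (y (j + 1)) - B z)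

variable [CompleteSpace H] {μ β ε : ℝ} {L : ℕ → ℝ} {z : H}

theorem IsNonlinearSRFBS.energySeq_succ_le (h : IsNonlinearSRFBS A B C S M γ xPrev x y u)
    (hS : StronglyPositive S) (hA : MaximallyMonotone A) (hB : MonotoneOp B) (hμ : 0 ≤ μ)
    (hBL : LipschitzWrt S μ B) (hβ : 0 < β) (hC : CocoerciveWrt S β⁻¹ C) (hγ : 0 < γ)
    (hL : ∀ k, 0 ≤ L k) (hM : ∀ k, LipschitzWrt S (L k) (fun z => γ • M k z - S z))
    (hz : -(B z + C z) ∈ A z) {j : ℕ}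
    (h₁ : ε ≤ 1 - 3 * L (j + 2) - L (j + 1) - 5 / 2 * (γ * β) - γ * μ * (√2 + 1))
    (h₂ : 0 ≤ 1 - L (j + 1) - L j - γ * μ * (√2 + 1)) :
    energySeq S B γ μ β L x y u z (j + 1) + ε * normWrt S (x (j + 3) - x (j + 2)) ^ 2
      ≤ energySeq S B γ μ β L x y u z j := by
  -- The shift by two keeps the arbitrary `u 0` and `xPrev` out: only momenta produced by the update
  -- and reflections given by `y_succ` occur.
  have ha := h.mem hγ (j + 2)
  have ha' := h.mem hγ (j + 1)
  have hyj : y (j + 2) = (2 : ℝ) • x (j + 2) - x (j + 1) := h.y_succ (j + 1)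
  have hyj' : y (j + 1) = (2 : ℝ) • x (j + 1) - x j := h.y_succ j
  have key := energy_le hS (γ := γ) (μ := μ) (β := β) (l₀ := L j) (l₁ := L (j + 1))
    (l₂ := L (j + 2)) (d₁ := x (j + 1) - x j) (d₂ := x (j + 2) - x (j + 1))
    (d₃ := x (j + 3) - x (j + 2)) (r := x (j + 2) - z) (u₁ := u (j + 1)) (u₂ := u (j + 2))
    (u₃ := u (j + 3)) (b₁ := B (y (j + 1)) - B z) (b₂ := B (y (j + 2)) - B z)
    (c := C (x (j + 2)) - C z) (c' := C (x (j + 2)) - C (x (j + 1))) hγ hμ hβ (hL j) (hL _)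
    ?_ ?_ ?_ ?_ (hC _ _) (hC.lipschitzWrt hS hβ _ _) (h.momentum_le hM j)
    (h.momentum_le hM (j + 1))
  · have e : x (j + 2) - z + (x (j + 3) - x (j + 2)) = x (j + 3) - z := by abel
    rw [e] at key
    have k1 := mul_le_mul_of_nonneg_right h₁ (sq_nonneg (normWrt S (x (j + 3) - x (j + 2))))
    have k2 := mul_nonneg h₂ (sq_nonneg
      (normWrt S (x (j + 3) - x (j + 2) - (x (j + 2) - x (j + 1)))))
    simp only [energySeq]
    linarith
  · have := mul_nonneg hγ.le (hA.monotone ha hz)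
    rw [← real_inner_smul_left] at this
    refine this.trans_eq (congrArg₂ (inner ℝ) ?_ (by abel))
    simp only [smul_sub γ, smul_inv_smul₀ hγ.ne']
    module
  · have := mul_nonneg hγ.le (hA.monotone ha ha')
    rw [← real_inner_smul_left] at this
    refine this.trans_eq (congrArg₂ (inner ℝ) ?_ rfl)
    simp only [smul_sub γ, smul_inv_smul₀ hγ.ne']
    module
  · have := hB (y (j + 2)) z
    refine this.trans_eq (congrArg₂ (inner ℝ) rfl ?_)
    rw [hyj]
    module
  · have := hBL (y (j + 2)) (y (j + 1))
    rw [sub_sub_sub_cancel_right]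
    convert this using 3
    rw [hyj, hyj']
    module

theorem IsNonlinearSRFBS.le_energySeq (h : IsNonlinearSRFBS A B C S M γ xPrev x y u)
    (hS : StronglyPositive S) (hμ : 0 ≤ μ) (hBL : LipschitzWrt S μ B) (hβ : 0 < β) (hγ : 0 < γ)
    (hL : ∀ k, 0 ≤ L k ∧ L k < 1) (hM : ∀ k, LipschitzWrt S (L k) (fun z => γ • M k z - S z))
    {j : ℕ} (h₂ : ε ≤ 1 - L (j + 1) - L j - γ * μ * (√2 + 1)) (z : H) :
    ε * normWrt S (x (j + 2) - z) ^ 2 ≤ energySeq S B γ μ β L x y u z j := by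
  refine le_energy hS hγ hμ hβ (hL _).1 (hL _).1 (hL _).2.le h₂ (h.momentum_le hM _)
    (h.momentum_le hM _) ?_
  convert hBL (y (j + 1)) z using 3
  rw [h.y_succ j]
  module

end Algorithm

end MonotoneSplitting

namespace MonotoneSplitting

/-! ### Asymptotic regularity and identification of cluster points. -/

section Convergence

variable {H : Type*} [NormedAddCommGroup H] [InnerProductSpace ℝ H] [CompleteSpace H]
  {S : H →L[ℝ] H}

theorem StronglyPositive.tendsto_zero (hS : StronglyPositive S) {d : ℕ → H}
    (hd : Tendsto (fun k => normWrt S (d k) ^ 2) atTop (𝓝 0)) : Tendsto d atTop (𝓝 0) := by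
  obtain ⟨K, -, hKn⟩ := hS.exists_norm_le
  refine squeeze_zero_norm (a := fun k => K * √(normWrt S (d k) ^ 2)) (fun k => ?_) ?_
  · rw [Real.sqrt_sq (normWrt_nonneg _ _)]
    exact hKn _
  · simpa using hd.sqrt.const_mul K

theorem StronglyPositive.tendsto_normWrt_sq (hS : StronglyPositive S) {d : ℕ → H}
    (hd : Tendsto d atTop (𝓝 0)) : Tendsto (fun k => normWrt S (d k) ^ 2) atTop (𝓝 0) := by
  simp only [hS.normWrt_sq]
  have h : Continuous fun v : H => ⟪S v, v⟫_ℝ := by fun_prop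
  simpa [Function.comp_def] using (h.tendsto 0).comp hd

theorem tendsto_atTop_zero_of_add_le {V a : ℕ → ℝ} {ε : ℝ} (hε : 0 < ε) (hV : ∀ j, 0 ≤ V j)
    (ha : ∀ j, 0 ≤ a j) (h : ∀ j, V (j + 1) + ε * a j ≤ V j) :
    (∃ m, Tendsto V atTop (𝓝 m)) ∧ Tendsto a atTop (𝓝 0) := by
  have hanti : Antitone V := antitone_nat_of_succ_le fun j => by
    linarith [h j, mul_nonneg hε.le (ha j)]
  have hlim := tendsto_atTop_ciInf hanti ⟨0, by rintro _ ⟨j, rfl⟩; exact hV j⟩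
  refine ⟨⟨_, hlim⟩, squeeze_zero ha (g := fun j => ε⁻¹ * (V j - V (j + 1))) (fun j => ?_) ?_⟩
  · rw [inv_mul_eq_div, le_div_iff₀ hε]
    linarith [h j]
  · simpa using (hlim.sub (hlim.comp (tendsto_add_atTop_nat 1))).const_mul ε⁻¹

variable {A : H → Set H} {B C : H → H} {M : ℕ → H → H} {γ μ β ε : ℝ} {L : ℕ → ℝ} {xPrev : H}
  {x y u : ℕ → H}

theorem IsNonlinearSRFBS.tendsto_momentum (h : IsNonlinearSRFBS A B C S M γ xPrev x y u)
    (hS : StronglyPositive S) (hL : ∀ k, 0 ≤ L k ∧ L k < 1)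
    (hM : ∀ k, LipschitzWrt S (L k) (fun z => γ • M k z - S z))
    (hd : Tendsto (fun k => x (k + 1) - x k) atTop (𝓝 0)) : Tendsto u atTop (𝓝 0) := by
  rw [← tendsto_add_atTop_iff_nat 1]
  refine squeeze_zero_norm (a := fun k => √‖S‖ * (√‖S‖ * ‖x (k + 1) - x k‖)) (fun k => ?_) ?_
  · refine (hS.norm_le_inverse _).trans (mul_le_mul_of_nonneg_left ?_ (Real.sqrt_nonneg _))
    refine (h.momentum_le hM k).trans (le_trans ?_ (normWrt_le S _))
    exact mul_le_of_le_one_left (normWrt_nonneg _ _) (hL k).2.le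
  · simpa using (hd.norm.const_mul √‖S‖).const_mul √‖S‖

omit [CompleteSpace H] in
theorem IsNonlinearSRFBS.tendsto_reflection_sub (h : IsNonlinearSRFBS A B C S M γ xPrev x y u)
    (hd : Tendsto (fun k => x (k + 1) - x k) atTop (𝓝 0)) :
    Tendsto (fun j => y (j + 1) - x (j + 2)) atTop (𝓝 0) := by
  have := hd.sub (hd.comp (tendsto_add_atTop_nat 1))
  rw [sub_zero] at this
  refine this.congr fun j => ?_
  simp only [Function.comp_apply, h.y_succ j]
  module

/-- Every other term of the energy contains a vanishing increment or momentum times a bounded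
factor. This transfers convergence of the energy to the distances required by Opial's lemma. -/
theorem IsNonlinearSRFBS.tendsto_energySeq_sub (h : IsNonlinearSRFBS A B C S M γ xPrev x y u)
    (hS : StronglyPositive S) (hμ : 0 ≤ μ) (hBL : LipschitzWrt S μ B)
    (hL : ∀ k, 0 ≤ L k ∧ L k < 1) (hM : ∀ k, LipschitzWrt S (L k) (fun z => γ • M k z - S z))
    (hd : Tendsto (fun k => x (k + 1) - x k) atTop (𝓝 0)) {R : ℝ} {z : H}
    (hR : ∀ j, ‖x (j + 2) - z‖ ≤ R) :
    Tendsto (fun j => energySeq S B γ μ β L x y u z j - normWrt S (x (j + 2) - z) ^ 2) atTop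
      (𝓝 0) := by
  have hu := h.tendsto_momentum hS hL hM hd
  have hu1 : Tendsto (fun j => u (j + 1)) atTop (𝓝 0) := hu.comp (tendsto_add_atTop_nat 1)
  have hu2 : Tendsto (fun j => u (j + 2)) atTop (𝓝 0) := hu.comp (tendsto_add_atTop_nat 2)
  have hd1 : Tendsto (fun j => x (j + 2) - x (j + 1)) atTop (𝓝 0) :=
    hd.comp (tendsto_add_atTop_nat 1)
  obtain ⟨K, hK0, hK⟩ := hS.exists_norm_sub_le hμ hBL
  have hBb : ∀ᶠ j in atTop, ‖B (y (j + 1)) - B z‖ ≤ K * (1 + R) := by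
    have hy := (h.tendsto_reflection_sub hd).norm
    rw [norm_zero] at hy
    filter_upwards [hy.eventually_le_const zero_lt_one] with j hj
    refine (hK _ _).trans (mul_le_mul_of_nonneg_left ?_ hK0)
    rw [← sub_add_sub_cancel _ (x (j + 2))]
    exact (norm_add_le _ _).trans (add_le_add hj (hR j))
  have hd1b : ∀ᶠ j in atTop, ‖x (j + 2) - x (j + 1)‖ ≤ 1 := by
    have := hd1.norm
    rw [norm_zero] at this
    exact this.eventually_le_const zero_lt_one
  have t1 := (tendsto_inner_zero hu2 (Eventually.of_forall hR)).const_mul 2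
  have t2 := (tendsto_inner_zero hd1 hBb).const_mul (2 * γ)
  have t3 := hS.tendsto_normWrt_sq hd1
  have t4 := (tendsto_inner_zero (by simpa using hu2.sub hu1) hd1b).const_mul 2
  have t5 : Tendsto (fun j => (3 * L (j + 1)) * normWrt S (x (j + 2) - x (j + 1)) ^ 2) atTop
      (𝓝 0) := by
    refine squeeze_zero (fun j => mul_nonneg (mul_nonneg (by norm_num) (hL _).1) (sq_nonneg _))
      (fun j => mul_le_mul_of_nonneg_right (?_ : _ ≤ (3 : ℝ)) (sq_nonneg _))
      (by simpa using t3.const_mul 3)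
    linarith [(hL (j + 1)).2]
  have t6 := t3.const_mul (γ * β + γ * μ * (√2 + 1))
  have t7 : Tendsto (fun j => L j * normWrt S (x (j + 1) - x j) ^ 2) atTop (𝓝 0) :=
    squeeze_zero (fun j => mul_nonneg (hL _).1 (sq_nonneg _))
      (fun j => mul_le_of_le_one_left (sq_nonneg _) (hL j).2.le) (hS.tendsto_normWrt_sq hd)
  have t8 := (hS.tendsto_normWrt_sq (by simpa using hd1.sub hd)).const_mul (γ * μ)
  have := ((((((t1.add t2).add t3).add t4).add t5).add t6).add t7).add t8
  simp only [mul_zero, add_zero] at this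
  refine this.congr fun j => ?_
  simp only [energySeq, energy, real_inner_comm (B (y (j + 1)) - B z)]
  ring

/-- In the step inclusion, `B` and `C` are evaluated at points whose distance to the new iterate
vanishes, so the residual in `A + B + C` at that iterate tends strongly to zero. -/
theorem IsNonlinearSRFBS.mem_zer_of_tendsto (h : IsNonlinearSRFBS A B C S M γ xPrev x y u)
    (hS : StronglyPositive S) (hA : MaximallyMonotone A) (hB : MonotoneOp B) (hμ : 0 ≤ μ)
    (hBL : LipschitzWrt S μ B) (hβ : 0 < β) (hC : CocoerciveWrt S β⁻¹ C) (hγ : 0 < γ)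
    (hL : ∀ k, 0 ≤ L k ∧ L k < 1) (hM : ∀ k, LipschitzWrt S (L k) (fun z => γ • M k z - S z))
    (hd : Tendsto (fun k => x (k + 1) - x k) atTop (𝓝 0)) {R : ℝ} (hR : ∀ j, ‖x (j + 2)‖ ≤ R)
    {l : Filter ℕ} [l.NeBot] (hl : l ≤ atTop) {p : H}
    (hp : ∀ w, Tendsto (fun j => ⟪w, x (j + 2)⟫_ℝ) l (𝓝 ⟪w, p⟫_ℝ)) :
    p ∈ zer (sumOp A B C) := by
  obtain ⟨K, hK0, hK⟩ := hS.exists_norm_sub_le hμ hBL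
  obtain ⟨K', hK0', hK'⟩ := hS.exists_norm_sub_le hβ.le (hC.lipschitzWrt hS hβ)
  have hu := h.tendsto_momentum hS hL hM hd
  have hu1 : Tendsto (fun j => u (j + 1)) atTop (𝓝 0) := hu.comp (tendsto_add_atTop_nat 1)
  have hu2 : Tendsto (fun j => u (j + 2)) atTop (𝓝 0) := hu.comp (tendsto_add_atTop_nat 2)
  have hd1 : Tendsto (fun j => x (j + 2) - x (j + 1)) atTop (𝓝 0) :=
    hd.comp (tendsto_add_atTop_nat 1)
  rw [mem_zer_sumOp]
  refine hA.neg_mem_of_tendsto (F := fun v => B v + C v) (add_nonneg hK0 hK0') (fun a b => ?_)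
    (fun a b => ?_) hp hR (fun j => h.mem hγ (j + 1)) (Tendsto.mono_left ?_ hl)
  · rw [add_sub_add_comm, add_mul]
    exact (norm_add_le _ _).trans (add_le_add (hK _ _) (hK' _ _))
  · rw [add_sub_add_comm, inner_add_left]
    exact add_nonneg (hB a b) (hC.monotoneOp (inv_nonneg.2 hβ.le) a b)
  · have t1 : Tendsto (fun j => B (x (j + 2)) - B (y (j + 1))) atTop (𝓝 0) := by
      refine squeeze_zero_norm (fun j => (hK _ _).trans_eq (by rw [norm_sub_rev])) ?_
      simpa using (h.tendsto_reflection_sub hd).norm.const_mul K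
    have t2 : Tendsto (fun j => C (x (j + 2)) - C (x (j + 1))) atTop (𝓝 0) := by
      refine squeeze_zero_norm (fun j => hK' _ _) ?_
      simpa using hd1.norm.const_mul K'
    have t3 : Tendsto (fun j => -S (x (j + 2) - x (j + 1))) atTop (𝓝 0) := by
      simpa using ((S.continuous.tendsto 0).comp hd1).neg
    have := ((((t3.sub hu2).add hu1).const_smul γ⁻¹).add t1).add t2
    simp only [sub_zero, add_zero, smul_zero] at this
    refine this.congr fun j => ?_
    abel

end Convergence

end MonotoneSplitting

/-! ### Weak convergence of the iterates. -/

theorem mainTheorem2 {H : Type*} [NormedAddCommGroup H] [InnerProductSpace ℝ H] [CompleteSpace H]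
    (A : H → Set H) (B C : H → H) (S : H →L[ℝ] H) (M : ℕ → H → H)
    (μ β γ ε₂ : ℝ) (L : ℕ → ℝ)
    (hS : MonotoneSplitting.StronglyPositive S)
    (hA : MonotoneSplitting.MaximallyMonotone A)
    (hB : MonotoneSplitting.MonotoneOp B)
    (hμ : 0 ≤ μ) (hBL : MonotoneSplitting.LipschitzWrt S μ B)
    (hβ : 0 < β) (hC : MonotoneSplitting.CocoerciveWrt S β⁻¹ C)
    (hzer : (MonotoneSplitting.zer (MonotoneSplitting.sumOp A B C)).Nonempty)
    (hγ : 0 < γ)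
    (hL : ∀ k : ℕ, 0 ≤ L k ∧ L k < 1)
    (hM : ∀ k : ℕ, MonotoneSplitting.LipschitzWrt S (L k) (fun z => γ • M k z - S z))
    (hε₂ : 0 < ε₂)
    (hparam : ∃ ε : ℝ, 0 < ε ∧
      (∀ k : ℕ, 1 ≤ k →
        ε ≤ 1 - 3 * L k - (2 + ε₂ + 2 * ε₂ ^ 2) * γ * β / (2 * ε₂) - L (k - 1)
          - γ * μ * (√2 + 1)) ∧
      (∀ k : ℕ, 2 ≤ k →
        ε ≤ 1 - L (k - 1) - L (k - 2) - γ * μ * (√2 + 1)))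
    (xPrev : H) (x y u : ℕ → H)
    (halg : MonotoneSplitting.IsNonlinearSRFBS A B C S M γ xPrev x y u) :
    ∃ xStar ∈ MonotoneSplitting.zer (MonotoneSplitting.sumOp A B C),
      Tendsto (fun k => toWeakSpace ℝ H (x k)) atTop (𝓝 (toWeakSpace ℝ H xStar)) := by
  obtain ⟨ε, hε, hp₁, hp₂⟩ := hparam
  -- The factor is `1 / ε₂ + 1 / 2 + ε₂`, smallest at `ε₂ = 1`, so every admissible `ε₂` reduces to
  -- the constant `5 / 2`.
  have hc : 5 / 2 * (γ * β) ≤ (2 + ε₂ + 2 * ε₂ ^ 2) * γ * β / (2 * ε₂) := by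
    rw [le_div_iff₀ (by positivity)]
    linarith [mul_nonneg (mul_nonneg hγ.le hβ.le) (sq_nonneg (ε₂ - 1))]
  have h₁ : ∀ j, ε ≤ 1 - 3 * L (j + 2) - L (j + 1) - 5 / 2 * (γ * β) - γ * μ * (√2 + 1) :=
    fun j => by
      have := hp₁ (j + 2) (by omega)
      rw [show j + 2 - 1 = j + 1 by omega] at this
      linarith
  have h₂ : ∀ j, ε ≤ 1 - L (j + 1) - L j - γ * μ * (√2 + 1) := fun j => hp₂ (j + 2) (by omega)
  have hV : ∀ z j, ε * MonotoneSplitting.normWrt S (x (j + 2) - z) ^ 2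
      ≤ MonotoneSplitting.energySeq S B γ μ β L x y u z j :=
    fun z j => halg.le_energySeq hS hμ hBL hβ hγ hL hM (h₂ j) z
  have hstep : ∀ z ∈ MonotoneSplitting.zer (MonotoneSplitting.sumOp A B C), ∀ j,
      MonotoneSplitting.energySeq S B γ μ β L x y u z (j + 1)
        + ε * MonotoneSplitting.normWrt S (x (j + 3) - x (j + 2)) ^ 2
        ≤ MonotoneSplitting.energySeq S B γ μ β L x y u z j :=
    fun z hz j => halg.energySeq_succ_le hS hA hB hμ hBL hβ hC hγ (fun k => (hL k).1) hM
      (MonotoneSplitting.mem_zer_sumOp.1 hz) (h₁ j) (hε.le.trans (h₂ j))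
  have hconv := fun z hz => MonotoneSplitting.tendsto_atTop_zero_of_add_le hε
    (fun j => (mul_nonneg hε.le (sq_nonneg _)).trans (hV z j)) (fun j => sq_nonneg _) (hstep z hz)
  obtain ⟨z₀, hz₀⟩ := hzer
  have hd : Tendsto (fun k => x (k + 1) - x k) atTop (𝓝 0) :=
    (tendsto_add_atTop_iff_nat 2).1 (hS.tendsto_zero (hconv z₀ hz₀).2)
  have hbd : ∀ z ∈ MonotoneSplitting.zer (MonotoneSplitting.sumOp A B C),
      ∃ R, ∀ j, ‖x (j + 2) - z‖ ≤ R := by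
    intro z hz
    obtain ⟨K, hK0, hK⟩ := hS.exists_norm_le
    have hanti : Antitone (MonotoneSplitting.energySeq S B γ μ β L x y u z) :=
      antitone_nat_of_succ_le fun j => by
        linarith [hstep z hz j, mul_nonneg hε.le
          (sq_nonneg (MonotoneSplitting.normWrt S (x (j + 3) - x (j + 2))))]
    refine ⟨K * √(MonotoneSplitting.energySeq S B γ μ β L x y u z 0 / ε), fun j =>
      (hK _).trans (mul_le_mul_of_nonneg_left (Real.le_sqrt_of_sq_le ?_) hK0)⟩
    rw [le_div_iff₀ hε, mul_comm]
    exact (hV z j).trans (hanti (Nat.zero_le j))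
  obtain ⟨R₀, hR₀⟩ := hbd z₀ hz₀
  have hR : ∀ j, ‖x (j + 2)‖ ≤ R₀ + ‖z₀‖ := fun j => by
    linarith [norm_le_norm_sub_add (x (j + 2)) z₀, hR₀ j]
  obtain ⟨p, hpZ, hpl⟩ := hS.exists_tendsto_weak (x := fun j => x (j + 2)) hR (fun z hz => by
    obtain ⟨⟨m, hm⟩, -⟩ := hconv z hz
    obtain ⟨R, hRz⟩ := hbd z hz
    refine ⟨m - 0, (hm.sub (halg.tendsto_energySeq_sub (β := β) hS hμ hBL hL hM hd hRz)).congr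
      fun j => ?_⟩
    exact sub_sub_cancel _ _) fun F hF p hp =>
      halg.mem_zer_of_tendsto hS hA hB hμ hBL hβ hC hγ hL hM hd hR hF hp
  exact ⟨p, hpZ, (tendsto_add_atTop_iff_nat (f := fun k => toWeakSpace ℝ H (x k)) 2).1 hpl⟩
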